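/- Work either in the category $\mathbf{Top}$ of topological spaces and continuous maps, with $\simeq$ denoting homotopy of maps, or in the category $\mathbf{Top^w}$ of well-pointed spaces (the inclusion of the base point is a closed cofibration) and continuous base point preserving maps, with $\simeq$ denoting homotopy relative to the base point. For maps $f\colon X\to Y$ and $\iota\colon A\to Y$, let $\mathrm{liftcat}^{\mathrm{op}}_f(\iota)\in\mathbb{N}\cup\{\infty\}$ be the least integer $n\ge 0$ for which there exist an open cover $(U_i)_{0\le i\le n}$ of $X$ and maps $l_i\colon U_i\to A$ such that $\iota\circ l_i\simeq f|_{U_i}$ for all $i$, and $\infty$ if there is no such $n$; in $\mathbf{Top^w}$ each $U_i$ is required to contain the base point of $X$, and the maps $l_i$ and the homotopies are pointed. Put $\mathrm{secat}^{\mathrm{op}}(\iota)=\mathrm{liftcat}^{\mathrm{op}}_{\mathrm{id}_Y}(\iota)$. A square given by maps $q\colon P\to X$, $p\colon P\to A$, $f\colon X\to Y$, $\iota\colon A\to Y$ is a homotopy pullback if there is a homotopy $H$ from $f\circ q$ to $\iota\circ p$ for which the map $z\mapsto (q(z),H(z,-),p(z))$ from $P$ to the space of triples $(x,\gamma,a)$,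 where $x\in X$, $a\in A$ and $\gamma$ is a path in $Y$ from $f(x)$ to $\iota(a)$, is a homotopy equivalence (everything being pointed in $\mathbf{Top^w}$). Then, in each of the two categories, $\mathrm{secat}^{\mathrm{op}}$ satisfies the following axioms. - **S0.** For every map $\iota\colon A\to Y$, $\mathrm{secat}^{\mathrm{op}}(\iota)=0$ if and only if there is a map $s\colon Y\to A$ with $\iota\circ s\simeq\mathrm{id}_Y$. - **S1.** If $\zeta\colon B\to A$, $\kappa\colon B\to X$ and $\iota\colon A\to X$ are maps with $\kappa\simeq\iota\circ\zeta$, then $\mathrm{secat}^{\mathrm{op}}(\iota)\le\mathrm{secat}^{\mathrm{op}}(\kappa)$. - **S2.** If $q\colon P\to X$, $p\colon P\to A$, $f\colon X\to Y$, $\iota\colon A\to Y$ form a homotopy pullback, then $\mathrm{secat}^{\mathrm{op}}(q)\le\mathrm{secat}^{\mathrm{op}}(\iota)$. Moreover, for every homotopy pullback as in S2, $\mathrm{liftcat}^{\mathrm{op}}_f(\iota)=\mathrm{secat}^{\mathrm{op}}(q)$. -/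

import Mathlib

open scoped unitInterval

universe u v w

noncomputable section

namespace SecatOp

/-! ### Free (unpointed) maps -/

section Free

variable {X : Type u} {Y : Type v} {A : Type w}
  [TopologicalSpace X] [TopologicalSpace Y] [TopologicalSpace A]

/-- `X` has an open cover `U 0, …, U n` such that over each `U i` the map `f` lifts through `ι` up
to homotopy. -/
def HasCategoricalCover (f : C(X, Y)) (ι : C(A, Y)) (n : ℕ) : Prop :=
  ∃ U : Fin (n + 1) → Set X, (∀ i, IsOpen (U i)) ∧ (⋃ i, U i) = Set.univ ∧
    ∀ i, ∃ l : C(U i, A), (ι.comp l).Homotopic (f.restrict (U i))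

/-- The lifting category from `f` to `ι` by open covers: the least `n` for which there is a
categorical cover by `n + 1` open sets, and `⊤` if there is none. -/
def liftcatOp (f : C(X, Y)) (ι : C(A, Y)) : ℕ∞ :=
  ⨅ (n : ℕ) (_ : HasCategoricalCover f ι n), (n : ℕ∞)

/-- The sectional category by open covers. -/
def secatOp (ι : C(A, Y)) : ℕ∞ := liftcatOp (ContinuousMap.id Y) ι

/-- The double mapping path space (standard homotopy pullback): triples `(x, γ, a)` where `γ` is a
path in `Y` from `f x` to `ι a`, with the compact-open topology on paths. -/
abbrev DoublePathSpace (f : C(X, Y)) (ι : C(A, Y)) : Type (max u v w) :=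
  {e : X × C(I, Y) × A // e.2.1 0 = f e.1 ∧ e.2.1 1 = ι e.2.2}

/-- The map `z ↦ (q z, t ↦ H (t, z), p z)` to the double mapping path space determined by a square
that commutes up to the homotopy `H`. -/
def comparisonMap {P : Type*} [TopologicalSpace P] {q : C(P, X)} {p : C(P, A)} {f : C(X, Y)}
    {ι : C(A, Y)} (H : (f.comp q).Homotopy (ι.comp p)) : C(P, DoublePathSpace f ι) where
  toFun z := ⟨(q z, (H.toContinuousMap.comp ContinuousMap.prodSwap).curry z, p z), by
    constructor <;> simp⟩
  continuous_toFun := by fun_prop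

/-- `h` is a homotopy equivalence. -/
def IsHomotopyEquiv (h : C(X, Y)) : Prop :=
  ∃ k : C(Y, X), (k.comp h).Homotopic (ContinuousMap.id X) ∧
    (h.comp k).Homotopic (ContinuousMap.id Y)

/-- The square with `q : P → X`, `p : P → A`, `f : X → Y`, `ι : A → Y` is a homotopy pullback:
it commutes up to a homotopy for which the induced map from `P` to the standard homotopy pullback
is a homotopy equivalence. -/
def IsHomotopyPullback {P : Type*} [TopologicalSpace P] (q : C(P, X)) (p : C(P, A)) (f : C(X, Y))
    (ι : C(A, Y)) : Prop :=
  ∃ H : (f.comp q).Homotopy (ι.comp p), IsHomotopyEquiv (comparisonMap H)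

end Free

/-- The axioms S0, S1, S2 of a sectional category on topological spaces and continuous maps. -/
structure IsSectionalCategory
    (secat : ∀ {A Y : Type u} [TopologicalSpace A] [TopologicalSpace Y], C(A, Y) → ℕ∞) :
    Prop where
  s0 : ∀ {A Y : Type u} [TopologicalSpace A] [TopologicalSpace Y] (ι : C(A, Y)),
    secat ι = 0 ↔ ∃ s : C(Y, A), (ι.comp s).Homotopic (ContinuousMap.id Y)
  s1 : ∀ {A B X : Type u} [TopologicalSpace A] [TopologicalSpace B] [TopologicalSpace X]
    (ζ : C(B, A)) (κ : C(B, X)) (ι : C(A, X)),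
    κ.Homotopic (ι.comp ζ) → secat ι ≤ secat κ
  s2 : ∀ {P A X Y : Type u} [TopologicalSpace P] [TopologicalSpace A] [TopologicalSpace X]
    [TopologicalSpace Y] (q : C(P, X)) (p : C(P, A)) (f : C(X, Y)) (ι : C(A, Y)),
    IsHomotopyPullback q p f ι → secat q ≤ secat ι

/-! ### Well-pointed spaces and pointed maps -/

/-- A well-pointed space: the inclusion of the base point is a closed cofibration, that is, the
base point is closed and its inclusion has the homotopy extension property. -/
structure WellPointedSpace where
  carrier : Type u
  [top : TopologicalSpace carrier]
  pt : carrier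
  isClosed_pt : IsClosed ({pt} : Set carrier)
  extend_homotopy : ∀ (Z : Type u) [TopologicalSpace Z] (g : C(carrier, Z)) (γ : C(I, Z)),
    γ 0 = g pt → ∃ G : C(I × carrier, Z), (∀ x, G (0, x) = g x) ∧ ∀ t, G (t, pt) = γ t

instance : CoeSort WellPointedSpace.{u} (Type u) := ⟨WellPointedSpace.carrier⟩

instance (X : WellPointedSpace.{u}) : TopologicalSpace X := X.top

/-- A continuous map that preserves base points. -/
structure PointedMap (X Y : WellPointedSpace.{u}) where
  map : C(X, Y)
  map_pt : map X.pt = Y.pt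

namespace PointedMap

variable {X Y Z : WellPointedSpace.{u}}

/-- The identity pointed map. -/
def id (X : WellPointedSpace.{u}) : PointedMap X X := ⟨ContinuousMap.id X, rfl⟩

/-- The composite of pointed maps. -/
def comp (g : PointedMap Y Z) (f : PointedMap X Y) : PointedMap X Z :=
  ⟨g.map.comp f.map, by simp [f.map_pt, g.map_pt]⟩

/-- Pointed homotopy: homotopy relative to the base point. -/
def Homotopic (f g : PointedMap X Y) : Prop := f.map.HomotopicRel g.map {X.pt}

end PointedMap

section Pointed

variable {X Y A P : WellPointedSpace.{u}}

/-- `X` has an open cover `U 0, …, U n` by sets that contain the base point, such that over each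
`U i` the map `f` lifts through `ι` by a pointed map, up to pointed homotopy. -/
def HasPointedCategoricalCover (f : PointedMap X Y) (ι : PointedMap A Y) (n : ℕ) : Prop :=
  ∃ U : Fin (n + 1) → Set X, (∀ i, IsOpen (U i)) ∧ (⋃ i, U i) = Set.univ ∧
    ∀ i, ∃ (hi : X.pt ∈ U i) (l : C(U i, A)), l ⟨X.pt, hi⟩ = A.pt ∧
      (ι.map.comp l).HomotopicRel (f.map.restrict (U i)) {⟨X.pt, hi⟩}

/-- The pointed lifting category by open covers. -/
def pointedLiftcatOp (f : PointedMap X Y) (ι : PointedMap A Y) : ℕ∞ :=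
  ⨅ (n : ℕ) (_ : HasPointedCategoricalCover f ι n), (n : ℕ∞)

/-- The pointed sectional category by open covers. -/
def pointedSecatOp (ι : PointedMap A Y) : ℕ∞ := pointedLiftcatOp (PointedMap.id Y) ι

/-- The base point of the double mapping path space of pointed maps: its path is constant. -/
def doublePathPt (f : PointedMap X Y) (ι : PointedMap A Y) : DoublePathSpace f.map ι.map :=
  ⟨(X.pt, ContinuousMap.const I Y.pt, A.pt), by simp [f.map_pt, ι.map_pt]⟩

/-- `h` is a pointed homotopy equivalence from `(S, s)` to `(T, t)`. -/
def IsPointedHomotopyEquiv {S T : Type*} [TopologicalSpace S] [TopologicalSpace T] (s : S) (t : T)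
    (h : C(S, T)) : Prop :=
  h s = t ∧ ∃ k : C(T, S), k t = s ∧ (k.comp h).HomotopicRel (ContinuousMap.id S) {s} ∧
    (h.comp k).HomotopicRel (ContinuousMap.id T) {t}

/-- A square of well-pointed spaces is a homotopy pullback: it commutes up to a pointed homotopy
for which the induced map from `P` to the standard homotopy pullback is a pointed homotopy
equivalence. -/
def IsPointedHomotopyPullback (q : PointedMap P X) (p : PointedMap P A) (f : PointedMap X Y)
    (ι : PointedMap A Y) : Prop :=
  ∃ H : (f.map.comp q.map).HomotopyRel (ι.map.comp p.map) {P.pt},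
    IsPointedHomotopyEquiv P.pt (doublePathPt f ι) (comparisonMap H.toHomotopy)

end Pointed

/-- The axioms S0, S1, S2 of a sectional category on well-pointed spaces and pointed maps. -/
structure IsPointedSectionalCategory
    (secat : ∀ {A Y : WellPointedSpace.{u}}, PointedMap A Y → ℕ∞) : Prop where
  s0 : ∀ {A Y : WellPointedSpace.{u}} (ι : PointedMap A Y),
    secat ι = 0 ↔ ∃ s : PointedMap Y A, (ι.comp s).Homotopic (PointedMap.id Y)
  s1 : ∀ {A B X : WellPointedSpace.{u}} (ζ : PointedMap B A) (κ : PointedMap B X)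
    (ι : PointedMap A X), κ.Homotopic (ι.comp ζ) → secat ι ≤ secat κ
  s2 : ∀ {P A X Y : WellPointedSpace.{u}} (q : PointedMap P X) (p : PointedMap P A)
    (f : PointedMap X Y) (ι : PointedMap A Y),
    IsPointedHomotopyPullback q p f ι → secat q ≤ secat ι

end SecatOp

end

/-!
Both categories are instances of one relative theory: maps of pairs, with homotopies fixed on the
subspace. The empty subspace gives `Top` and the base point gives pointed maps.

A homotopy `ι ∘ l ≃ f ∘ j` is the same thing as a map `(j, γ, l)` from the source of `j` into the
double mapping path space. In a homotopy pullback the comparison map has a homotopy section, and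
composing `(j, γ, l)` with it gives a lift of `j` through `q`; conversely `p` turns lifts through
`q` into lifts through `ι`. Hence the very same open covers compute `liftcat f ι` and `secat q`.
Axiom S2 follows since a cover of `Y` for `ι` pulls back along `f`.
-/

namespace SecatOp

section Relative

variable {X Y A B P W : Type*} [TopologicalSpace X] [TopologicalSpace Y] [TopologicalSpace A]
  [TopologicalSpace B] [TopologicalSpace P] [TopologicalSpace W]
  {X₀ : Set X} {Y₀ : Set Y} {A₀ : Set A} {B₀ : Set B} {P₀ : Set P} {W₀ : Set W}

theorem homotopicRel_precomp {g₀ g₁ : C(X, Y)} (h : g₀.HomotopicRel g₁ X₀) {k : C(W, X)}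
    (hk : Set.MapsTo k W₀ X₀) : (g₀.comp k).HomotopicRel (g₁.comp k) W₀ :=
  h.map fun G ↦ ⟨G.toHomotopy.compContinuousMap k, fun t _ hw ↦ G.prop t _ (hk hw)⟩

/-- The map `g` lifts through `ι`, up to homotopy relative to `W₀`, by a map of pairs
`(W, W₀) → (A, A₀)`. -/
def HasRelLift (W₀ : Set W) (A₀ : Set A) (g : C(W, Y)) (ι : C(A, Y)) : Prop :=
  ∃ l : C(W, A), Set.MapsTo l W₀ A₀ ∧ (ι.comp l).HomotopicRel g W₀

theorem HasRelLift.precomp {g : C(X, Y)} {ι : C(A, Y)} (h : HasRelLift X₀ A₀ g ι) {k : C(W, X)}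
    (hk : Set.MapsTo k W₀ X₀) : HasRelLift W₀ A₀ (g.comp k) ι := by
  obtain ⟨l, hl, hιl⟩ := h
  exact ⟨l.comp k, hl.comp hk, homotopicRel_precomp hιl hk⟩

theorem HasRelLift.of_homotopicRel_comp {g : C(W, Y)} {κ : C(B, Y)} {ι : C(A, Y)} {ζ : C(B, A)}
    (h : HasRelLift W₀ B₀ g κ) (hζ : Set.MapsTo ζ B₀ A₀)
    (hκ : κ.HomotopicRel (ι.comp ζ) B₀) : HasRelLift W₀ A₀ g ι := by
  obtain ⟨l, hl, hκl⟩ := h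
  exact ⟨ζ.comp l, hζ.comp hl, (homotopicRel_precomp hκ.symm hl).trans hκl⟩

/-- `X` has an open cover by `n + 1` sets containing `X₀`, over each of which `f` lifts through `ι`
relative to `X₀`. -/
def HasRelCategoricalCover (X₀ : Set X) (A₀ : Set A) (f : C(X, Y)) (ι : C(A, Y)) (n : ℕ) : Prop :=
  ∃ U : Fin (n + 1) → Set X, (∀ i, IsOpen (U i)) ∧ (⋃ i, U i) = Set.univ ∧
    ∀ i, X₀ ⊆ U i ∧ HasRelLift (Subtype.val ⁻¹' X₀) A₀ (f.restrict (U i)) ι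

theorem hasRelCategoricalCover_zero_iff {f : C(X, Y)} {ι : C(A, Y)} :
    HasRelCategoricalCover X₀ A₀ f ι 0 ↔ HasRelLift X₀ A₀ f ι := by
  constructor
  · rintro ⟨U, -, hcover, hU⟩
    have hU₀ : ∀ x, x ∈ U 0 := by simpa [Set.eq_univ_iff_forall] using hcover
    let e : C(X, U 0) := ⟨fun x ↦ ⟨x, hU₀ x⟩, by fun_prop⟩
    exact (hU 0).2.precomp (k := e) fun _ hx ↦ hx
  · intro h
    exact ⟨fun _ ↦ Set.univ, fun _ ↦ isOpen_univ, Set.iUnion_const _, fun _ ↦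
      ⟨Set.subset_univ _, h.precomp (k := (ContinuousMap.id X).restrict _) fun _ hx ↦ hx⟩⟩

theorem HasRelCategoricalCover.precomp {g : C(X, Y)} {ι : C(A, Y)} {n : ℕ}
    (h : HasRelCategoricalCover X₀ A₀ g ι n) {f : C(W, X)} (hf : Set.MapsTo f W₀ X₀) :
    HasRelCategoricalCover W₀ A₀ (g.comp f) ι n := by
  obtain ⟨U, hopen, hcover, hU⟩ := h
  refine ⟨fun i ↦ f ⁻¹' U i, fun i ↦ (hopen i).preimage f.continuous,
    by rw [← Set.preimage_iUnion, hcover, Set.preimage_univ], fun i ↦ ?_⟩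
  exact ⟨fun _ hw ↦ (hU i).1 (hf hw),
    (hU i).2.precomp (k := f.restrictPreimage (U i)) fun _ hw ↦ hf hw⟩

theorem HasRelCategoricalCover.of_homotopicRel_comp {f : C(X, Y)} {κ : C(B, Y)} {ι : C(A, Y)}
    {ζ : C(B, A)} {n : ℕ} (h : HasRelCategoricalCover X₀ B₀ f κ n) (hζ : Set.MapsTo ζ B₀ A₀)
    (hκ : κ.HomotopicRel (ι.comp ζ) B₀) : HasRelCategoricalCover X₀ A₀ f ι n := by
  obtain ⟨U, hopen, hcover, hU⟩ := h
  exact ⟨U, hopen, hcover, fun i ↦ ⟨(hU i).1, (hU i).2.of_homotopicRel_comp hζ hκ⟩⟩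

/-- The lifting category of maps of pairs by open covers. -/
noncomputable def relLiftcatOp (X₀ : Set X) (A₀ : Set A) (f : C(X, Y)) (ι : C(A, Y)) : ℕ∞ :=
  ⨅ (n : ℕ) (_ : HasRelCategoricalCover X₀ A₀ f ι n), (n : ℕ∞)

/-- The sectional category of maps of pairs by open covers. -/
noncomputable def relSecatOp (A₀ : Set A) (Y₀ : Set Y) (ι : C(A, Y)) : ℕ∞ :=
  relLiftcatOp Y₀ A₀ (ContinuousMap.id Y) ι

theorem relLiftcatOp_eq_zero_iff {f : C(X, Y)} {ι : C(A, Y)} :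
    relLiftcatOp X₀ A₀ f ι = 0 ↔ HasRelLift X₀ A₀ f ι := by
  simp [relLiftcatOp, hasRelCategoricalCover_zero_iff]

theorem relLiftcatOp_comp_le {f : C(W, X)} (hf : Set.MapsTo f W₀ X₀) (g : C(X, Y)) (ι : C(A, Y)) :
    relLiftcatOp W₀ A₀ (g.comp f) ι ≤ relLiftcatOp X₀ A₀ g ι :=
  biInf_mono fun _ h ↦ h.precomp hf

theorem relLiftcatOp_le_of_homotopicRel_comp {κ : C(B, Y)} {ι : C(A, Y)} {ζ : C(B, A)}
    (hζ : Set.MapsTo ζ B₀ A₀) (hκ : κ.HomotopicRel (ι.comp ζ) B₀) (f : C(X, Y)) :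
    relLiftcatOp X₀ A₀ f ι ≤ relLiftcatOp X₀ B₀ f κ :=
  biInf_mono fun _ h ↦ h.of_homotopicRel_comp hζ hκ

/-- The constant paths over `X₀` and `A₀`: the subspace that makes the double mapping path space
the standard homotopy pullback of pairs. -/
def constPaths (X₀ : Set X) (A₀ : Set A) (f : C(X, Y)) (ι : C(A, Y)) :
    Set (DoublePathSpace f ι) :=
  {e | e.1.1 ∈ X₀ ∧ e.1.2.1 = ContinuousMap.const I (f e.1.1) ∧ e.1.2.2 ∈ A₀}

theorem mapsTo_comparisonMap_constPaths {q : C(P, X)} {p : C(P, A)} {f : C(X, Y)} {ι : C(A, Y)}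
    (H : (f.comp q).HomotopyRel (ι.comp p) P₀) (hq : Set.MapsTo q P₀ X₀)
    (hp : Set.MapsTo p P₀ A₀) :
    Set.MapsTo (comparisonMap H.toHomotopy) P₀ (constPaths X₀ A₀ f ι) :=
  fun _ hz ↦ ⟨hq hz, ContinuousMap.ext fun t ↦ H.eq_fst t hz, hp hz⟩

/-- The first projection of the double mapping path space. -/
def doublePathFst (f : C(X, Y)) (ι : C(A, Y)) : C(DoublePathSpace f ι, X) where
  toFun e := e.1.1

/-- `h` is a homotopy equivalence of pairs `(X, X₀) → (Y, Y₀)`, in the strong sense that the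
homotopies are stationary on `X₀` and `Y₀`. -/
def IsRelHomotopyEquiv (X₀ : Set X) (Y₀ : Set Y) (h : C(X, Y)) : Prop :=
  Set.MapsTo h X₀ Y₀ ∧ ∃ k : C(Y, X), Set.MapsTo k Y₀ X₀ ∧
    (k.comp h).HomotopicRel (ContinuousMap.id X) X₀ ∧
    (h.comp k).HomotopicRel (ContinuousMap.id Y) Y₀

/-- A square of maps of pairs is a homotopy pullback: it commutes up to a homotopy relative to `P₀`
for which the comparison map to the standard homotopy pullback of pairs is an equivalence. -/
def IsRelHomotopyPullback (P₀ : Set P) (X₀ : Set X) (A₀ : Set A) (q : C(P, X)) (p : C(P, A))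
    (f : C(X, Y)) (ι : C(A, Y)) : Prop :=
  ∃ H : (f.comp q).HomotopyRel (ι.comp p) P₀,
    IsRelHomotopyEquiv P₀ (constPaths X₀ A₀ f ι) (comparisonMap H.toHomotopy)

namespace IsRelHomotopyPullback

variable {q : C(P, X)} {p : C(P, A)} {f : C(X, Y)} {ι : C(A, Y)}

theorem hasRelLift_of_comp (h : IsRelHomotopyPullback P₀ X₀ A₀ q p f ι) {j : C(W, X)}
    (hj : Set.MapsTo j W₀ X₀) (hl : HasRelLift W₀ A₀ (f.comp j) ι) : HasRelLift W₀ P₀ j q := by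
  obtain ⟨H, -, k, hk, -, hHk⟩ := h
  obtain ⟨l, hl, ⟨G⟩⟩ := hl
  have hG := mapsTo_comparisonMap_constPaths G.symm hj hl
  exact ⟨k.comp (comparisonMap G.symm.toHomotopy), hk.comp hG,
    homotopicRel_precomp (hHk.comp_continuousMap (doublePathFst f ι)) hG⟩

theorem hasRelLift_comp (h : IsRelHomotopyPullback P₀ X₀ A₀ q p f ι) {j : C(W, X)}
    (hs : HasRelLift W₀ P₀ j q) : HasRelLift W₀ A₀ (f.comp j) ι := by
  obtain ⟨H, hH, -⟩ := h
  obtain ⟨s, hs, hqs⟩ := hs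
  have hp : Set.MapsTo p P₀ A₀ := fun _ hz ↦ (hH hz).2.2
  have hfq : HasRelLift W₀ P₀ (f.comp j) (f.comp q) := ⟨s, hs, hqs.comp_continuousMap f⟩
  exact hfq.of_homotopicRel_comp hp ⟨H⟩

theorem hasRelCategoricalCover_iff (h : IsRelHomotopyPullback P₀ X₀ A₀ q p f ι) {n : ℕ} :
    HasRelCategoricalCover X₀ A₀ f ι n ↔
      HasRelCategoricalCover X₀ P₀ (ContinuousMap.id X) q n := by
  refine exists_congr fun U ↦ and_congr_right fun _ ↦ and_congr_right fun _ ↦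
    forall_congr' fun i ↦ and_congr_right fun _ ↦ ?_
  exact ⟨h.hasRelLift_of_comp (j := (ContinuousMap.id X).restrict (U i)) fun _ hx ↦ hx,
    h.hasRelLift_comp⟩

theorem relLiftcatOp_eq_relSecatOp (h : IsRelHomotopyPullback P₀ X₀ A₀ q p f ι) :
    relLiftcatOp X₀ A₀ f ι = relSecatOp P₀ X₀ q := by
  simp only [relSecatOp, relLiftcatOp, h.hasRelCategoricalCover_iff]

theorem relSecatOp_le (h : IsRelHomotopyPullback P₀ X₀ A₀ q p f ι) (hf : Set.MapsTo f X₀ Y₀) :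
    relSecatOp P₀ X₀ q ≤ relSecatOp A₀ Y₀ ι :=
  h.relLiftcatOp_eq_relSecatOp.symm.trans_le (relLiftcatOp_comp_le hf (ContinuousMap.id Y) ι)

end IsRelHomotopyPullback

end Relative

/-- The axioms S0, S1, S2 of a sectional category on pairs of spaces, with homotopies relative to
the subspaces. The value `secat A₀ Y₀ ι` is that of `ι : (A, A₀) → (Y, Y₀)`. -/
structure IsRelSectionalCategory
    (secat : ∀ {A Y : Type u} [TopologicalSpace A] [TopologicalSpace Y],
      Set A → Set Y → C(A, Y) → ℕ∞) : Prop where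
  s0 : ∀ {A Y : Type u} [TopologicalSpace A] [TopologicalSpace Y] (A₀ : Set A) (Y₀ : Set Y)
    (ι : C(A, Y)), secat A₀ Y₀ ι = 0 ↔ HasRelLift Y₀ A₀ (ContinuousMap.id Y) ι
  s1 : ∀ {A B X : Type u} [TopologicalSpace A] [TopologicalSpace B] [TopologicalSpace X]
    {A₀ : Set A} {B₀ : Set B} (X₀ : Set X) (ζ : C(B, A)) (κ : C(B, X)) (ι : C(A, X)),
    Set.MapsTo ζ B₀ A₀ → κ.HomotopicRel (ι.comp ζ) B₀ → secat A₀ X₀ ι ≤ secat B₀ X₀ κ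
  s2 : ∀ {P A X Y : Type u} [TopologicalSpace P] [TopologicalSpace A] [TopologicalSpace X]
    [TopologicalSpace Y] {P₀ : Set P} {A₀ : Set A} {X₀ : Set X} {Y₀ : Set Y}
    (q : C(P, X)) (p : C(P, A)) (f : C(X, Y)) (ι : C(A, Y)), Set.MapsTo f X₀ Y₀ →
    IsRelHomotopyPullback P₀ X₀ A₀ q p f ι → secat P₀ X₀ q ≤ secat A₀ Y₀ ι

section Free

variable {X Y A P : Type*} [TopologicalSpace X] [TopologicalSpace Y] [TopologicalSpace A]
  [TopologicalSpace P]

theorem hasRelLift_empty_iff {f : C(X, Y)} {A₀ : Set A} {ι : C(A, Y)} :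
    HasRelLift ∅ A₀ f ι ↔ ∃ l : C(X, A), (ι.comp l).Homotopic f := by
  simp [HasRelLift, Set.mapsTo_empty]

theorem liftcatOp_eq_relLiftcatOp (f : C(X, Y)) (ι : C(A, Y)) :
    liftcatOp f ι = relLiftcatOp ∅ ∅ f ι := by
  simp [liftcatOp, relLiftcatOp, HasCategoricalCover, HasRelCategoricalCover,
    hasRelLift_empty_iff]

theorem secatOp_eq_relSecatOp (ι : C(A, Y)) : secatOp ι = relSecatOp ∅ ∅ ι :=
  liftcatOp_eq_relLiftcatOp _ _

theorem isRelHomotopyEquiv_empty_iff {h : C(X, Y)} :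
    IsRelHomotopyEquiv ∅ ∅ h ↔ IsHomotopyEquiv h := by
  simp [IsRelHomotopyEquiv, IsHomotopyEquiv]

theorem constPaths_empty (f : C(X, Y)) (ι : C(A, Y)) : constPaths ∅ ∅ f ι = ∅ := by
  simp [constPaths]

theorem IsHomotopyPullback.isRelHomotopyPullback {q : C(P, X)} {p : C(P, A)} {f : C(X, Y)}
    {ι : C(A, Y)} (h : IsHomotopyPullback q p f ι) : IsRelHomotopyPullback ∅ ∅ ∅ q p f ι := by
  obtain ⟨H, hH⟩ := h
  refine ⟨⟨H, fun _ _ ↦ False.elim⟩, ?_⟩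
  rwa [constPaths_empty, isRelHomotopyEquiv_empty_iff]

end Free

section Pointed

variable {X Y A P : WellPointedSpace.{u}}

theorem hasRelLift_pt_iff {f : PointedMap X Y} {ι : PointedMap A Y} :
    HasRelLift {X.pt} {A.pt} f.map ι.map ↔ ∃ s : PointedMap X A, (ι.comp s).Homotopic f :=
  ⟨fun ⟨l, hl, h⟩ ↦ ⟨⟨l, hl rfl⟩, h⟩,
    fun ⟨s, h⟩ ↦ ⟨s.map, Set.mapsTo_singleton.2 s.map_pt, h⟩⟩

theorem hasPointedCategoricalCover_iff {f : PointedMap X Y} {ι : PointedMap A Y} {n : ℕ} :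
    HasPointedCategoricalCover f ι n ↔
      HasRelCategoricalCover {X.pt} {A.pt} f.map ι.map n := by
  refine exists_congr fun U ↦ and_congr_right fun _ ↦ and_congr_right fun _ ↦
    forall_congr' fun i ↦ ?_
  rw [Set.singleton_subset_iff, ← exists_prop]
  refine exists_congr fun hi ↦ ?_
  have hpt : (Subtype.val ⁻¹' {X.pt} : Set (U i)) = {⟨X.pt, hi⟩} :=
    Set.ext fun _ ↦ (Subtype.ext_iff (a2 := ⟨X.pt, hi⟩)).symm
  simp only [HasRelLift, hpt, Set.mapsTo_singleton, Set.mem_singleton_iff]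

theorem pointedLiftcatOp_eq_relLiftcatOp (f : PointedMap X Y) (ι : PointedMap A Y) :
    pointedLiftcatOp f ι = relLiftcatOp {X.pt} {A.pt} f.map ι.map := by
  simp only [pointedLiftcatOp, relLiftcatOp, hasPointedCategoricalCover_iff]

theorem pointedSecatOp_eq_relSecatOp (ι : PointedMap A Y) :
    pointedSecatOp ι = relSecatOp {A.pt} {Y.pt} ι.map :=
  pointedLiftcatOp_eq_relLiftcatOp _ _

theorem isRelHomotopyEquiv_singleton_iff {S T : Type*} [TopologicalSpace S] [TopologicalSpace T]
    {s : S} {t : T} {h : C(S, T)} :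
    IsRelHomotopyEquiv {s} {t} h ↔ IsPointedHomotopyEquiv s t h := by
  simp only [IsRelHomotopyEquiv, IsPointedHomotopyEquiv, Set.mapsTo_singleton,
    Set.mem_singleton_iff]

theorem constPaths_pt (f : PointedMap X Y) (ι : PointedMap A Y) :
    constPaths {X.pt} {A.pt} f.map ι.map = {doublePathPt f ι} := by
  ext ⟨⟨x, γ, a⟩, _⟩
  simp only [constPaths, doublePathPt, Set.mem_ofPred_eq, Set.mem_singleton_iff, Subtype.mk.injEq,
    Prod.mk.injEq]
  refine and_congr_right fun hx ↦ ?_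
  rw [hx, f.map_pt]

theorem IsPointedHomotopyPullback.isRelHomotopyPullback {q : PointedMap P X} {p : PointedMap P A}
    {f : PointedMap X Y} {ι : PointedMap A Y} (h : IsPointedHomotopyPullback q p f ι) :
    IsRelHomotopyPullback {P.pt} {X.pt} {A.pt} q.map p.map f.map ι.map := by
  obtain ⟨H, hH⟩ := h
  refine ⟨H, ?_⟩
  rwa [constPaths_pt, isRelHomotopyEquiv_singleton_iff]

end Pointed

namespace IsRelSectionalCategory

variable {secat : ∀ {A Y : Type u} [TopologicalSpace A] [TopologicalSpace Y],
  Set A → Set Y → C(A, Y) → ℕ∞}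

theorem free (h : IsRelSectionalCategory.{u} secat) :
    IsSectionalCategory.{u} fun ι ↦ secat ∅ ∅ ι where
  s0 ι := (h.s0 ∅ ∅ ι).trans hasRelLift_empty_iff
  s1 ζ κ ι hκ := h.s1 ∅ ζ κ ι (Set.mapsTo_empty _ _) (ContinuousMap.homotopicRel_empty.2 hκ)
  s2 q p f ι hP := h.s2 q p f ι (Set.mapsTo_empty _ _) hP.isRelHomotopyPullback

theorem pointed (h : IsRelSectionalCategory.{u} secat) :
    IsPointedSectionalCategory.{u} fun {A Y} ι ↦ secat {A.pt} {Y.pt} ι.map where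
  s0 ι := (h.s0 _ _ ι.map).trans (hasRelLift_pt_iff (f := PointedMap.id _))
  s1 ζ κ ι hκ := h.s1 _ ζ.map κ.map ι.map (Set.mapsTo_singleton.2 ζ.map_pt) hκ
  s2 q p f ι hP := h.s2 q.map p.map f.map ι.map (Set.mapsTo_singleton.2 f.map_pt)
    hP.isRelHomotopyPullback

end IsRelSectionalCategory

end SecatOp

theorem mainTheorem4_general :
    SecatOp.IsRelSectionalCategory.{u} SecatOp.relSecatOp ∧
    ∀ {P A X Y : Type u} [TopologicalSpace P] [TopologicalSpace A] [TopologicalSpace X]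
      [TopologicalSpace Y] {P₀ : Set P} {A₀ : Set A} {X₀ : Set X} (q : C(P, X)) (p : C(P, A))
      (f : C(X, Y)) (ι : C(A, Y)), SecatOp.IsRelHomotopyPullback P₀ X₀ A₀ q p f ι →
        SecatOp.relLiftcatOp X₀ A₀ f ι = SecatOp.relSecatOp P₀ X₀ q :=
  ⟨{ s0 := fun _ _ _ ↦ SecatOp.relLiftcatOp_eq_zero_iff
     s1 := fun _ _ _ _ hζ hκ ↦ SecatOp.relLiftcatOp_le_of_homotopicRel_comp hζ hκ _
     s2 := fun _ _ _ _ hf h ↦ h.relSecatOp_le hf },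
    fun _ _ _ _ h ↦ h.relLiftcatOp_eq_relSecatOp⟩

theorem mainTheorem4 :
    SecatOp.IsSectionalCategory.{u} SecatOp.secatOp ∧
    (∀ {P A X Y : Type u} [TopologicalSpace P] [TopologicalSpace A] [TopologicalSpace X]
      [TopologicalSpace Y] (q : C(P, X)) (p : C(P, A)) (f : C(X, Y)) (ι : C(A, Y)),
      SecatOp.IsHomotopyPullback q p f ι → SecatOp.liftcatOp f ι = SecatOp.secatOp q) ∧
    SecatOp.IsPointedSectionalCategory.{u} SecatOp.pointedSecatOp ∧
    (∀ {P A X Y : SecatOp.WellPointedSpace.{u}} (q : SecatOp.PointedMap P X)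
      (p : SecatOp.PointedMap P A) (f : SecatOp.PointedMap X Y) (ι : SecatOp.PointedMap A Y),
      SecatOp.IsPointedHomotopyPullback q p f ι →
        SecatOp.pointedLiftcatOp f ι = SecatOp.pointedSecatOp q) := by
  obtain ⟨hsecat, hpullback⟩ := mainTheorem4_general.{u}
  refine ⟨?_, fun _ _ _ _ h ↦ ?_, ?_, fun _ _ _ _ h ↦ ?_⟩
  · simpa only [← SecatOp.secatOp_eq_relSecatOp] using hsecat.free
  · simpa only [SecatOp.liftcatOp_eq_relLiftcatOp, SecatOp.secatOp_eq_relSecatOp]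
      using hpullback _ _ _ _ h.isRelHomotopyPullback
  · simpa only [← SecatOp.pointedSecatOp_eq_relSecatOp] using hsecat.pointed
  · simpa only [SecatOp.pointedLiftcatOp_eq_relLiftcatOp, SecatOp.pointedSecatOp_eq_relSecatOp]
      using hpullback _ _ _ _ h.isRelHomotopyPullback
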